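/- Theorem (Weingarten formula). Let $N, n \ge 0$ be integers with $N>n$. Let $S_n$ be the group of permutations of $\{1,\dots,n\}$, with $(\sigma\theta)(a)=\sigma(\theta(a))$. For $\sigma\in S_n$ let $\#\sigma$ be the number of cycles of $\sigma$, fixed points being counted as cycles, and put $$\Phi^N=\sum_{\sigma\in S_n}N^{\#\sigma}\,\sigma\in\mathbb C[S_n].$$ Then $\Phi^N$ is invertible in the group algebra $\mathbb C[S_n]$. Write $(\Phi^N)^{-1}=\sum_{\sigma\in S_n}W^N_\sigma\,\sigma$. Let $dU$ be the Haar probability measure on the unitary group $\mathcal U(N)$. For $U\in\mathcal U(N)$ let $u_{ij}$ be the entries of $U$ and $u^*_{ij}=(U^*)_{ij}=\overline{u_{ji}}$ the entries of its adjoint. Then for all indices $i_1,\dots,i_n,\ j_1,\dots,j_n,\ r_1,\dots,r_n,\ s_1,\dots,s_n\in\{1,\dots,N\}$, $$\int_{\mathcal U(N)}u_{i_1r_1}\cdots u_{i_nr_n}\,u^*_{s_1j_1}\cdots u^*_{s_nj_n}\,dU=\sum_{\sigma,\theta}W^N_{\sigma\theta^{-1}},$$ where the sum runs over all pairs $\sigma,\theta\in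 S_n$ such that $j_a=i_{\sigma(a)}$ for $a=1,\dots,n$ and $s_b=r_{\theta(b)}$ for $b=1,\dots,n$. -/

import Mathlib

/-- The number of cycles of a permutation, fixed points being counted as cycles of length one:
the number of classes of the relation "`x` and `y` lie in the same cycle of `σ`". -/
noncomputable def numCycles {n : ℕ} (σ : Equiv.Perm (Fin n)) : ℕ :=
  Nat.card (Quotient (Equiv.Perm.SameCycle.setoid σ))

/-- The element `Φ^N = ∑ σ, N ^ (number of cycles of σ) • σ` of the group algebra `ℂ[S_n]`. -/
noncomputable def weingartenPhi (N n : ℕ) : MonoidAlgebra ℂ (Equiv.Perm (Fin n)) :=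
  ∑ σ : Equiv.Perm (Fin n), MonoidAlgebra.single σ ((N : ℂ) ^ numCycles σ)

/-- The Weingarten coefficient `W^N_σ`: the coefficient of `σ` in the inverse of `Φ^N` in `ℂ[S_n]`
(meaningful when `Φ^N` is a unit; `Ring.inverse` is then the two-sided inverse). -/
noncomputable def weingartenCoeff (N n : ℕ) (σ : Equiv.Perm (Fin n)) : ℂ :=
  (Ring.inverse (weingartenPhi N n)).coeff σ

/-!
Fix the column indices `r` and `s`, and let `F` be the matrix of the integrals as functions of the
row multi-indices `i` and `j`. Left invariance of Haar measure says that `F` commutes with the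
tensor power `U ^ ⊗ n` of every unitary matrix `U` (`commute_unitaryMoment`). By Schur–Weyl duality
(`Matrix.apply_eq_sum_perm_of_commute_tensorPower_unitary`), `F` is a linear combination
`∑ σ, c σ • P σ` of the operators `P σ` permuting the tensor factors.

Duality is elementary when `n ≤ N`. Commuting with unitary diagonal matrices forces `F` to preserve
weights, hence to commute with all diagonal matrices; the spectral theorem then gives all Hermitian
matrices, and products of these with diagonal matrices give all matrices. Since `n ≤ N`, there is a
basis tensor with distinct factors. It is cyclic for the tensor powers of matrices, and its weight
space is spanned by its permutations, so a single row of `F` supplies the coefficients `c σ`.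

To find them, `F` is contracted along a permutation `τ`. On one side `Uᴴ * U = 1` turns the integral
into the indicator of `s = r ∘ τ` (`sum_unitaryMoment_comp`). On the other side, as the trace of a
permutation operator is `N` to the number of its cycles, the result is the coefficient of `τ` in the
product of `Φ = weingartenPhi N n` with `∑ σ, c σ • σ` (`sum_ite_comp_eq_coeff_weingartenPhi_mul`).
The element `Φ` is invertible because multiplication by it is given by the Gram matrix of the
operators `P σ`, which are linearly independent for `n ≤ N` (`isUnit_weingartenPhi`). Solving for
`c` gives the formula.
-/

/-! ### Tensor powers of matrices -/

namespace Matrix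

section TensorPower

variable {κ α : Type*} [Fintype α]

/-- The tensor power `M ^ ⊗ α` of a square matrix, acting on `(ℂ ^ κ) ^ ⊗ α`. The standard basis of
this space, consisting of tensor products of basis vectors, is indexed by functions `α → κ`, and the
entries of the tensor power are products of entries of `M`. -/
def tensorPower (α : Type*) [Fintype α] (M : Matrix κ κ ℂ) : Matrix (α → κ) (α → κ) ℂ :=
  of fun i k => ∏ a, M (i a) (k a)

theorem tensorPower_apply (M : Matrix κ κ ℂ) (i k : α → κ) :
    tensorPower α M i k = ∏ a, M (i a) (k a) := rfl

theorem tensorPower_mul [Fintype κ] [DecidableEq α] (A B : Matrix κ κ ℂ) :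
    tensorPower α (A * B) = tensorPower α A * tensorPower α B := by
  ext i k
  simp only [tensorPower_apply, mul_apply, ← Finset.prod_mul_distrib, Finset.prod_univ_sum,
    Fintype.piFinset_univ]

theorem tensorPower_diagonal [DecidableEq κ] (d : κ → ℂ) :
    tensorPower α (diagonal d) = diagonal fun i : α → κ => ∏ a, d (i a) := by
  ext i k
  rw [tensorPower_apply, diagonal_apply]
  split_ifs with h
  · simp [h]
  · obtain ⟨a, ha⟩ := Function.ne_iff.mp h
    exact Finset.prod_eq_zero (Finset.mem_univ a) (diagonal_apply_ne _ ha)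

theorem tensorPower_one [DecidableEq κ] : tensorPower α (1 : Matrix κ κ ℂ) = 1 := by
  rw [← diagonal_one, tensorPower_diagonal]
  simp

end TensorPower

/-- In the coordinates `p`, `q` the factorization is
`!![1, c; 0, 1] = !![1, c; star c, 0] * !![0, (star c)⁻¹; c⁻¹, 1 - (c * star c)⁻¹]`. -/
theorem transvection_eq_mul_isHermitian {κ : Type*} [Fintype κ] [DecidableEq κ] {p q : κ}
    (hpq : p ≠ q) (c : ℂ) :
    ∃ H K : Matrix κ κ ℂ, H.IsHermitian ∧ K.IsHermitian ∧ transvection p q c = H * K := by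
  by_cases hc : c = 0
  · exact ⟨1, 1, isHermitian_one, isHermitian_one, by simp [hc]⟩
  have hc' : star c ≠ 0 := star_ne_zero.mpr hc
  refine ⟨1 + (single p q c + single q p (star c)) - single q q 1,
    1 - single p p 1 + (single p q (star c)⁻¹ + single q p c⁻¹) - single q q (c * star c)⁻¹,
    ?_, ?_, ?_⟩
  · simp [IsHermitian, conjTranspose_single, add_comm]
  · simp [IsHermitian, conjTranspose_single, add_comm, mul_comm]
  · have hr : c * (c * star c)⁻¹ = (star c)⁻¹ := by field_simp
    have hpq0 (x y : κ) (u v : ℂ) : single x p u * single q y v = 0 :=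
      single_mul_single_of_ne _ _ _ _ hpq _
    have hqp0 (x y : κ) (u v : ℂ) : single x q u * single p y v = 0 :=
      single_mul_single_of_ne _ _ _ _ hpq.symm _
    simp only [transvection, mul_sub, mul_add, add_mul, sub_mul, one_mul, mul_one,
      single_mul_single_same, hpq0, hqp0, hr, mul_inv_cancel₀ hc, mul_inv_cancel₀ hc']
    abel

/-! ### The commutant of the tensor powers of unitary matrices -/

section Commutant

variable {κ α : Type*} [Fintype κ] [DecidableEq κ] [Fintype α] [DecidableEq α]
  {A : Matrix (α → κ) (α → κ) ℂ}

/-- A matrix commuting with the tensor powers of unitary matrices preserves weights: it has nonzero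
entries only between basis tensors whose factors agree up to order. Already commuting with the
tensor powers of unitary diagonal matrices forces this. -/
theorem map_univ_eq_of_commute_tensorPower_unitary
    (hA : ∀ U ∈ unitaryGroup κ ℂ, Commute A (tensorPower α U)) {i k : α → κ} (h : A i k ≠ 0) :
    Finset.univ.val.map i = Finset.univ.val.map k := by
  ext x
  -- The order of the root of unity `z` exceeds every multiplicity that a value can have in a
  -- function on `α`, so that the exponents of `z` can be compared.
  have hz := Complex.isPrimitiveRoot_exp (Fintype.card α + 1) (Nat.succ_ne_zero _)
  set z := Complex.exp (2 * Real.pi * Complex.I / ((Fintype.card α + 1 : ℕ) : ℂ))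
  have hU : diagonal (Pi.mulSingle x z) ∈ unitaryGroup κ ℂ := by
    rw [mem_unitaryGroup_iff, star_eq_conjTranspose, diagonal_conjTranspose,
      diagonal_mul_diagonal, ← diagonal_one]
    congr 1
    funext y
    have hz1 : z * star z = 1 := by
      rw [← starRingEnd_apply, Complex.mul_conj, Complex.normSq_eq_norm_sq,
        hz.norm'_eq_one (Nat.succ_ne_zero _)]
      simp
    by_cases hy : y = x
    · subst hy; simpa using hz1
    · simp [hy]
  have hprod (l : α → κ) : ∏ a, Pi.mulSingle (M := fun _ => ℂ) x z (l a) =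
      z ^ (Finset.univ.val.map l).count x := by
    simp only [Pi.mulSingle_apply, Finset.prod_ite, Finset.prod_const, one_pow, mul_one,
      Multiset.count_map, eq_comm (a := x)]
    rfl
  have hcard (l : α → κ) : (Finset.univ.val.map l).count x < Fintype.card α + 1 :=
    Nat.lt_succ_of_le ((Multiset.count_le_card _ _).trans (by simp))
  have hc := congrFun₂ (hA _ hU).eq i k
  rw [tensorPower_diagonal, mul_diagonal, diagonal_mul, mul_comm] at hc
  have := mul_right_cancel₀ h hc
  rw [hprod, hprod] at this
  exact (hz.pow_inj (hcard k) (hcard i) this).symm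

/-- Since a diagonal matrix acts on each weight space by a scalar, preservation of weights extends
the commutation from unitary diagonal matrices to all diagonal matrices. -/
theorem commute_tensorPower_diagonal
    (hA : ∀ U ∈ unitaryGroup κ ℂ, Commute A (tensorPower α U)) (d : κ → ℂ) :
    Commute A (tensorPower α (diagonal d)) := by
  ext i k
  rw [tensorPower_diagonal, mul_diagonal, diagonal_mul]
  by_cases h : A i k = 0
  · simp [h]
  have hm := map_univ_eq_of_commute_tensorPower_unitary hA h
  have hprod (l : α → κ) : ∏ a, d (l a) = ((Finset.univ.val.map l).map d).prod := by
    rw [Multiset.map_map]; rfl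
  rw [hprod, hprod, hm, mul_comm]

theorem commute_tensorPower_of_isHermitian
    (hA : ∀ U ∈ unitaryGroup κ ℂ, Commute A (tensorPower α U)) {H : Matrix κ κ ℂ}
    (hH : H.IsHermitian) : Commute A (tensorPower α H) := by
  rw [hH.spectral_theorem, Unitary.conjStarAlgAut_apply, tensorPower_mul, tensorPower_mul]
  exact ((hA _ (hH.eigenvectorUnitary).2).mul_right (commute_tensorPower_diagonal hA _)).mul_right
    (hA _ (star hH.eigenvectorUnitary).2)

/-- The unitarian trick: every matrix is a product of diagonal matrices and transvections, hence of
Hermitian matrices and diagonal ones, and the former are unitarily diagonalizable. -/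
theorem commute_tensorPower
    (hA : ∀ U ∈ unitaryGroup κ ℂ, Commute A (tensorPower α U)) (M : Matrix κ κ ℂ) :
    Commute A (tensorPower α M) := by
  refine diagonal_transvection_induction (fun M => Commute A (tensorPower α M)) M
    (fun d _ => commute_tensorPower_diagonal hA d) (fun t => ?_)
    fun B C hB hC => tensorPower_mul (α := α) B C ▸ hB.mul_right hC
  obtain ⟨H, K, hH, hK, h⟩ := transvection_eq_mul_isHermitian t.hij t.c
  rw [TransvectionStruct.toMatrix, h, tensorPower_mul]
  exact (commute_tensorPower_of_isHermitian hA hH).mul_right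
    (commute_tensorPower_of_isHermitian hA hK)

/-- Schur–Weyl duality in the stable range: a matrix commuting with the tensor powers of unitary
matrices is a linear combination of the matrices `(i, j) ↦ if j = i ∘ σ then 1 else 0` permuting the
tensor factors. The basis tensor indexed by an injection `e` is cyclic for the tensor powers of
matrices, so the row of index `e` determines the whole matrix; by preservation of weights that row
is supported on the permutations of `e`. -/
theorem apply_eq_sum_perm_of_commute_tensorPower_unitary
    (hA : ∀ U ∈ unitaryGroup κ ℂ, Commute A (tensorPower α U)) (e : α ↪ κ) (i j : α → κ) :
    A i j = ∑ σ : Equiv.Perm α, if j = i ∘ σ then A e (e ∘ σ) else 0 := by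
  -- `M` substitutes `i` for `e`: its row of index `e a` is the basis vector of index `i a`.
  let M : Matrix κ κ ℂ := of fun x y => if ∃ a, e a = x ∧ i a = y then 1 else 0
  have hM (f : α → α) (k : α → κ) : tensorPower α M (e ∘ f) k = if k = i ∘ f then 1 else 0 := by
    simp [tensorPower_apply, M, Finset.prod_ite_zero, funext_iff, eq_comm]
  have hc := congrFun₂ (commute_tensorPower hA M).eq e j
  simp only [mul_apply] at hc
  have hid := hM id
  simp only [Function.comp_id] at hid
  simp only [hid, ite_mul, one_mul, zero_mul, Finset.sum_ite_eq', Finset.mem_univ, if_true] at hc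
  rw [← hc]
  symm
  refine Finset.sum_of_injOn (fun σ : Equiv.Perm α => e ∘ σ) ?_ (by simp) ?_ ?_
  · intro σ _ τ _ h
    ext a
    exact e.injective (congrFun h a)
  · intro k _ hk
    by_contra hne
    have hm := map_univ_eq_of_commute_tensorPower_unitary hA (left_ne_zero_of_mul hne)
    have hinj : Function.Injective k := by
      rw [← Fintype.nodup_map_univ_iff_injective, ← hm, Fintype.nodup_map_univ_iff_injective]
      exact e.injective
    have hmem (a : α) : ∃ b, e b = k a := by
      have : k a ∈ Finset.univ.val.map e := hm ▸ Multiset.mem_map_of_mem k (Finset.mem_univ a)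
      simpa using this
    choose g hg using hmem
    have hgi : Function.Injective g := fun a b h => hinj (by rw [← hg, ← hg, h])
    refine hk ⟨Equiv.ofBijective g (Finite.injective_iff_bijective.mp hgi), by simp, ?_⟩
    funext a
    simp [hg]
  · intro σ _
    rw [hM]
    simp

end Commutant

end Matrix

open MeasureTheory

/-! ### Invertibility of the element `Φ` -/

section Gram

variable {N n : ℕ}

/-- The functions fixed by `σ` are those that are constant on its cycles. -/
theorem card_comp_eq_self (σ : Equiv.Perm (Fin n)) :
    Fintype.card {i : Fin n → Fin N // i ∘ σ = i} = N ^ numCycles σ := by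
  have key {i : Fin n → Fin N} (hi : i ∘ σ = i) {x y : Fin n} (h : σ.SameCycle x y) :
      i x = i y := by
    obtain ⟨k, rfl⟩ := h
    have hz : ∀ k : ℤ, ∀ x, i ((σ ^ k) x) = i x := by
      intro k
      induction k with
      | zero => simp
      | succ k ih => intro x; rw [zpow_add_one, Equiv.Perm.mul_apply, ih]; exact congrFun hi x
      | pred k ih =>
        intro x
        rw [zpow_sub_one, Equiv.Perm.mul_apply, ih]
        simpa using (congrFun hi (σ⁻¹ x)).symm
    exact (hz k x).symm
  let E : {i : Fin n → Fin N // i ∘ σ = i} ≃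
      (Quotient (Equiv.Perm.SameCycle.setoid σ) → Fin N) :=
    { toFun := fun i => Quotient.lift i.1 fun _ _ h => key i.2 h
      invFun := fun f => ⟨fun x => f ⟦x⟧, funext fun x => congrArg f
        (Quotient.sound (Equiv.Perm.sameCycle_apply_left.mpr (Equiv.Perm.SameCycle.refl σ x)))⟩
      left_inv := fun i => rfl
      right_inv := fun f => funext fun q => Quotient.inductionOn q fun _ => rfl }
  classical
  rw [← Nat.card_eq_fintype_card, Nat.card_congr E, Nat.card_fun, Nat.card_fin, numCycles]

/-- The Gram matrix of the operators permuting the factors of `(ℂ ^ N) ^ ⊗ n`, for the trace inner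
product, is `N ^ numCycles (τ * σ⁻¹)`. -/
theorem sum_ite_comp_eq_comp (σ τ : Equiv.Perm (Fin n)) :
    ∑ i : Fin n → Fin N, (if i ∘ τ = i ∘ σ then 1 else 0 : ℂ) =
      (N : ℂ) ^ numCycles (τ * σ⁻¹) := by
  have h (i : Fin n → Fin N) : i ∘ τ = i ∘ σ ↔ i ∘ (τ * σ⁻¹ : Equiv.Perm (Fin n)) = i := by
    rw [Equiv.Perm.coe_mul, ← Function.comp_assoc]
    constructor
    · intro h; rw [h]; ext; simp
    · intro h; nth_rw 2 [← h]; ext; simp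
  rw [← Nat.cast_pow, ← card_comp_eq_self, Fintype.card_subtype, Finset.sum_boole]
  simp only [h]

theorem coeff_weingartenPhi_mul (x : MonoidAlgebra ℂ (Equiv.Perm (Fin n)))
    (τ : Equiv.Perm (Fin n)) :
    (weingartenPhi N n * x).coeff τ = ∑ σ, (N : ℂ) ^ numCycles (τ * σ⁻¹) * x.coeff σ := by
  rw [weingartenPhi, Finset.sum_mul, MonoidAlgebra.coeff_sum, Finset.sum_apply']
  simp only [MonoidAlgebra.coeff_single_mul_apply]
  exact Fintype.sum_equiv ((Equiv.inv _).trans (Equiv.mulRight τ)) _ _ fun σ => by simp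

/-- Contracting a linear combination of the operators permuting tensor factors along the permutation
`τ` amounts to multiplying the group algebra element of its coefficients by `Φ`. -/
theorem sum_ite_comp_eq_coeff_weingartenPhi_mul (x : MonoidAlgebra ℂ (Equiv.Perm (Fin n)))
    (τ : Equiv.Perm (Fin n)) :
    ∑ i : Fin n → Fin N, ∑ σ : Equiv.Perm (Fin n), (if i ∘ τ = i ∘ σ then x.coeff σ else 0) =
      (weingartenPhi N n * x).coeff τ := by
  rw [coeff_weingartenPhi_mul, Finset.sum_comm]
  simp only [← sum_ite_comp_eq_comp, Finset.sum_mul, ite_mul, one_mul, zero_mul]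

open ComplexOrder in
/-- For `n ≤ N` the operators permuting the factors of `(ℂ ^ N) ^ ⊗ n` are linearly independent, and
multiplication by `Φ` is given by their Gram matrix: if it kills `x`, then the
combination `y` of these operators with coefficients `x` has Hilbert–Schmidt norm zero. -/
theorem eq_zero_of_weingartenPhi_mul_eq_zero (hN : n ≤ N)
    {x : MonoidAlgebra ℂ (Equiv.Perm (Fin n))} (hx : weingartenPhi N n * x = 0) : x = 0 := by
  let y (i j : Fin n → Fin N) : ℂ := ∑ σ : Equiv.Perm (Fin n), if j = i ∘ σ then x.coeff σ else 0
  have hy : ∑ i, ∑ j, star (y i j) * y i j = 0 := by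
    have hrow (i) : ∑ j, star (y i j) * y i j =
        ∑ τ : Equiv.Perm (Fin n), star (x.coeff τ) * y i (i ∘ τ) := by
      have hstar (j) : star (y i j) =
          ∑ τ : Equiv.Perm (Fin n), if j = i ∘ τ then star (x.coeff τ) else 0 := by
        simp only [y, star_sum, apply_ite star, star_zero]
      simp only [hstar, Finset.sum_mul]
      rw [Finset.sum_comm]
      simp
    calc ∑ i, ∑ j, star (y i j) * y i j
        = ∑ τ, star (x.coeff τ) * (weingartenPhi N n * x).coeff τ := by
          simp only [hrow]
          rw [Finset.sum_comm]
          simp only [← Finset.mul_sum, ← sum_ite_comp_eq_coeff_weingartenPhi_mul, y]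
      _ = 0 := by simp [hx]
  have hy0 (i j) : y i j = 0 := by
    have hnn (i j) : 0 ≤ star (y i j) * y i j := star_mul_self_nonneg _
    rw [Finset.sum_eq_zero_iff_of_nonneg fun i _ => Finset.sum_nonneg fun j _ => hnn i j] at hy
    have := hy i (Finset.mem_univ i)
    rw [Finset.sum_eq_zero_iff_of_nonneg fun j _ => hnn i j] at this
    simpa using this j (Finset.mem_univ j)
  ext σ
  have hinj : Function.Injective (Fin.castLE hN) := Fin.castLE_injective hN
  have := hy0 (Fin.castLE hN) (Fin.castLE hN ∘ σ)
  simpa [y, hinj.comp_left.eq_iff, DFunLike.coe_fn_eq] using this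

theorem isUnit_weingartenPhi (hN : n ≤ N) : IsUnit (weingartenPhi N n) := by
  have hinj : Function.Injective (LinearMap.mulLeft ℂ (weingartenPhi N n)) := by
    rw [injective_iff_map_eq_zero]
    exact fun x hx => eq_zero_of_weingartenPhi_mul_eq_zero hN hx
  obtain ⟨y, hy⟩ := LinearMap.injective_iff_surjective.mp hinj 1
  rw [LinearMap.mulLeft_apply] at hy
  refine ⟨⟨_, y, hy, hinj ?_⟩, rfl⟩
  simp [← mul_assoc, hy]

end Gram

/-! ### Moments of a random unitary matrix -/

section Haar

open Matrix

variable {κ α : Type*} [Fintype κ] [DecidableEq κ] [Fintype α]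
  [MeasurableSpace (unitaryGroup κ ℂ)] [BorelSpace (unitaryGroup κ ℂ)]
  (μ : Measure (unitaryGroup κ ℂ))

/-- The matrix, in the row indices `i`, `j`, of the integrals of
`∏ a, U (i a) (r a) * ∏ a, Uᴴ (s a) (j a)` over the unitary group, for fixed column indices
`r`, `s`. It represents the average of `U ^ ⊗ α * E * (Uᴴ) ^ ⊗ α`, where `E` is the matrix unit of
position `(r, s)`. -/
noncomputable def unitaryMoment (r s : α → κ) : Matrix (α → κ) (α → κ) ℂ :=
  of fun i j => ∫ U : unitaryGroup κ ℂ,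
    tensorPower α (U : Matrix κ κ ℂ) i r * tensorPower α (U : Matrix κ κ ℂ)ᴴ s j ∂μ

theorem integrable_tensorPower_mul [IsFiniteMeasure μ] (i r s j : α → κ) :
    Integrable (fun U : unitaryGroup κ ℂ =>
      tensorPower α (U : Matrix κ κ ℂ) i r * tensorPower α (U : Matrix κ κ ℂ)ᴴ s j) μ := by
  simp only [tensorPower_apply, conjTranspose_apply]
  have hcont (x y : κ) : Continuous fun U : unitaryGroup κ ℂ => (U : Matrix κ κ ℂ) x y :=
    continuous_subtype_val.matrix_elem x y
  refine Integrable.of_bound (C := 1) (Continuous.aestronglyMeasurable ?_) (.of_forall fun U => ?_)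
  · exact (continuous_finsetProd _ fun a _ => hcont _ _).mul
      (continuous_finsetProd _ fun a _ => (hcont _ _).star)
  · have hle (x y : κ) : ‖(U : Matrix κ κ ℂ) x y‖ ≤ 1 := entry_norm_bound_of_unitary U.2 x y
    rw [norm_mul, norm_prod, norm_prod]
    refine mul_le_one₀ (Finset.prod_le_one (fun _ _ => norm_nonneg _) fun a _ => hle _ _)
      (Finset.prod_nonneg fun _ _ => norm_nonneg _)
      (Finset.prod_le_one (fun _ _ => norm_nonneg _) fun a _ => ?_)
    rw [norm_star]
    exact hle _ _

/-- Invariance of the measure under left translation by `V`, in the form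
`V ^ ⊗ α * F = F * V ^ ⊗ α`. -/
theorem commute_unitaryMoment [DecidableEq α] [IsFiniteMeasure μ] [μ.IsMulLeftInvariant]
    (r s : α → κ) {V : Matrix κ κ ℂ} (hV : V ∈ unitaryGroup κ ℂ) :
    Commute (unitaryMoment μ r s) (tensorPower α V) := by
  ext i j
  set V' : unitaryGroup κ ℂ := ⟨V, hV⟩
  have hint := integrable_tensorPower_mul (α := α) μ
  calc (unitaryMoment μ r s * tensorPower α V) i j
      = ∫ U : unitaryGroup κ ℂ, tensorPower α (U : Matrix κ κ ℂ) i r *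
          tensorPower α ((U : Matrix κ κ ℂ)ᴴ * V) s j ∂μ := by
        simp only [mul_apply, unitaryMoment, of_apply, tensorPower_mul, Finset.mul_sum,
          ← mul_assoc]
        rw [integral_finsetSum _ fun k _ => (hint i r s k).mul_const _]
        simp only [integral_mul_const]
    _ = ∫ U : unitaryGroup κ ℂ, tensorPower α (V * (U : Matrix κ κ ℂ)) i r *
          tensorPower α (U : Matrix κ κ ℂ)ᴴ s j ∂μ := by
        rw [← integral_mul_left_eq_self _ V']
        have hVV : Vᴴ * V = 1 := mem_unitaryGroup_iff'.mp hV
        simp [V', conjTranspose_mul, mul_assoc, hVV]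
    _ = (tensorPower α V * unitaryMoment μ r s) i j := by
        simp only [mul_apply, unitaryMoment, of_apply, tensorPower_mul, Finset.sum_mul,
          mul_assoc]
        rw [integral_finsetSum _ fun k _ => (hint k r s j).const_mul _]
        simp only [integral_const_mul]

/-- Contracting the row indices along a permutation leaves the entry `(s ∘ τ⁻¹, r)` of the tensor
power of `Uᴴ * U = 1` under the integral. -/
theorem sum_unitaryMoment_comp [DecidableEq α] [IsProbabilityMeasure μ] (r s : α → κ)
    (τ : Equiv.Perm α) :
    ∑ i, unitaryMoment μ r s i (i ∘ τ) = if s = r ∘ τ then 1 else 0 := by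
  have hint := integrable_tensorPower_mul (α := α) μ
  have hcomp (M : Matrix κ κ ℂ) (i : α → κ) :
      tensorPower α M s (i ∘ τ) = tensorPower α M (s ∘ τ.symm) i := by
    simp only [tensorPower_apply, Function.comp_apply]
    exact Fintype.prod_equiv τ _ _ fun a => by simp
  simp only [unitaryMoment, of_apply]
  rw [← integral_finsetSum _ fun i _ => hint i r s (i ∘ τ)]
  have h (U : unitaryGroup κ ℂ) : ∑ i, tensorPower α (U : Matrix κ κ ℂ) i r *
      tensorPower α (U : Matrix κ κ ℂ)ᴴ s (i ∘ τ) = if s = r ∘ τ then 1 else 0 := by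
    have hUU : (U : Matrix κ κ ℂ)ᴴ * U = 1 := mem_unitaryGroup_iff'.mp U.2
    simp only [hcomp, mul_comm (tensorPower α (U : Matrix κ κ ℂ) _ r)]
    rw [← mul_apply, ← tensorPower_mul, hUU, tensorPower_one, one_apply]
    simp only [Equiv.comp_symm_eq]
  simp [h]

end Haar

/-! ### The Weingarten formula -/

theorem mainTheorem1 (N n : ℕ) (hN : n < N)
    [MeasurableSpace (Matrix.unitaryGroup (Fin N) ℂ)]
    [BorelSpace (Matrix.unitaryGroup (Fin N) ℂ)]
    (μ : MeasureTheory.Measure (Matrix.unitaryGroup (Fin N) ℂ))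
    [μ.IsHaarMeasure] [MeasureTheory.IsProbabilityMeasure μ] :
    IsUnit (weingartenPhi N n) ∧
    ∀ i j r s : Fin n → Fin N,
      ∫ U : Matrix.unitaryGroup (Fin N) ℂ,
          (∏ a, (U : Matrix (Fin N) (Fin N) ℂ) (i a) (r a)) *
            ∏ a, Matrix.conjTranspose (U : Matrix (Fin N) (Fin N) ℂ) (s a) (j a) ∂μ =
        ∑ p : Equiv.Perm (Fin n) × Equiv.Perm (Fin n) with
            (∀ a, j a = i (p.1 a)) ∧ (∀ b, s b = r (p.2 b)),
          weingartenCoeff N n (p.1 * p.2⁻¹) := by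
  refine ⟨isUnit_weingartenPhi hN.le, fun i j r s => ?_⟩
  let F := unitaryMoment μ r s
  let e := Fin.castLEEmb hN.le
  have hF (i j) : F i j = ∑ σ : Equiv.Perm (Fin n), if j = i ∘ σ then F e (e ∘ σ) else 0 :=
    Matrix.apply_eq_sum_perm_of_commute_tensorPower_unitary
      (fun U hU => commute_unitaryMoment μ r s hU) e i j
  let c : MonoidAlgebra ℂ (Equiv.Perm (Fin n)) :=
    .ofCoeff (Finsupp.equivFunOnFinite.symm fun σ => F e (e ∘ σ))
  let b : MonoidAlgebra ℂ (Equiv.Perm (Fin n)) :=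
    .ofCoeff (Finsupp.equivFunOnFinite.symm fun τ => if s = r ∘ τ then 1 else 0)
  have hc (σ) : c.coeff σ = F e (e ∘ σ) := rfl
  have hb (τ : Equiv.Perm (Fin n)) : b.coeff τ = if s = r ∘ τ then 1 else 0 := rfl
  -- The contractions of `F` along all permutations form a linear system with coefficients `Φ`.
  have hcb : weingartenPhi N n * c = b := by
    ext τ
    rw [hb, ← sum_unitaryMoment_comp μ r s τ, ← sum_ite_comp_eq_coeff_weingartenPhi_mul]
    exact Finset.sum_congr rfl fun i _ => (hF i (i ∘ τ)).symm
  have hc' : c = Ring.inverse (weingartenPhi N n) * b := by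
    rw [← hcb, Ring.inverse_mul_cancel_left _ _ (isUnit_weingartenPhi hN.le)]
  have hcσ (σ : Equiv.Perm (Fin n)) : F e (e ∘ σ) =
      ∑ θ : Equiv.Perm (Fin n), if s = r ∘ θ then weingartenCoeff N n (σ * θ⁻¹) else 0 := by
    rw [← hc, hc', MonoidAlgebra.coeff_mul_apply_right, Finsupp.sum_fintype _ _ (by simp)]
    simp [hb, weingartenCoeff]
  change F i j = _
  rw [hF, Finset.sum_filter, Fintype.sum_prod_type]
  refine Finset.sum_congr rfl fun σ _ => ?_
  simp only [hcσ, funext_iff, Function.comp_apply, ite_and]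
  split_ifs <;> simp
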